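/- Let $s$ and $d$ be relatively prime positive integers. A partition is a finite weakly decreasing sequence of positive integers (the empty sequence is allowed), drawn as a Young diagram; it is self-conjugate if its diagram is invariant under reflection along the main diagonal. The hook length of a box is the number of boxes strictly to its right in its row, plus the number of boxes strictly below it in its column, plus one. For $t\ge 1$, a partition is a $t$-core if no box of its diagram has hook length $t$, and it is an $(s,s+d,s+2d)$-core if it is simultaneously an $s$-core, an $(s+d)$-core and an $(s+2d)$-core. Write $\binom{n}{a,b,c}=\frac{n!}{a!\,b!\,c!}$ for nonnegative integers $a,b,c$ with $a+b+c=n$. Then the set of self-conjugate $(s,s+d,s+2d)$-core partitions (of all sizes) is finite, and the number of its elements is \[ \sum_{i=0}^{\lfloor s/4\rfloor}\binom{\frac{s+d-1}{2}}{\,i,\ \frac d2+i,\ \frac{s-1}{2}-2i\,}\quad\text{if $d$ is even,} \] \[ \sum_{i=0}^{\lfloor s/2\rfloor}\binom{\lfloor\frac{s+d-1}{2}\rfloor}{\,\lfloor\frac i2\rfloor,\ \lfloor\frac{d+i}{2}\rfloor,\ \lfloor\frac s2\rfloor-i\,}\quad\text{if $d$ is odd.} \] -/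

import Mathlib

/-- The hook length of the box in row `i` and column `j` of a Young diagram (rows and columns are
numbered from `0`): the arm (boxes of row `i` strictly to the right) plus the leg (boxes of
column `j` strictly below) plus the box itself. It is only meant for `(i, j) ∈ μ`. -/
def YoungDiagram.hookLength (μ : YoungDiagram) (i j : ℕ) : ℕ :=
  (μ.rowLen i - (j + 1)) + (μ.colLen j - (i + 1)) + 1

/-- A partition, given by its Young diagram, is a `t`-core if no box has hook length `t`. -/
def YoungDiagram.IsCore (μ : YoungDiagram) (t : ℕ) : Prop :=
  ∀ i j : ℕ, (i, j) ∈ μ → μ.hookLength i j ≠ t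

/-- A partition is self-conjugate if reflecting its diagram in the main diagonal fixes it. -/
def YoungDiagram.IsSelfConjugate (μ : YoungDiagram) : Prop :=
  μ.transpose = μ

/-- The self-conjugate `(s, s + d, s + 2 d)`-core partitions (of all sizes). -/
def selfConjugateCores (s d : ℕ) : Set YoungDiagram :=
  {μ | μ.IsSelfConjugate ∧ μ.IsCore s ∧ μ.IsCore (s + d) ∧ μ.IsCore (s + 2 * d)}

/-- The trinomial coefficient `n! / (a! b! c!)`, for `a + b + c = n`
(and `0` if the lower entries do not add up to `n`). -/
def trinomial (n a b c : ℕ) : ℕ :=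
  if a + b + c = n then Nat.multinomial Finset.univ ![a, b, c] else 0

/-!
A partition with row lengths `λ₀ ≥ λ₁ ≥ ⋯` is encoded by its beta set `{λ_i - i - 1} ⊆ ℤ`. It is a
`t`-core exactly when the beta set is closed under subtracting `t` (`YoungDiagram.isCore_iff`), and
self-conjugate exactly when the beta set is exchanged with its complement by `x ↦ -1 - x`
(`YoungDiagram.isSelfConjugate_iff`). Conversely every symmetric set that is bounded above is a beta
set (`YoungDiagram.exists_betaSet_eq`).

Put `n = s + d`. The three closure conditions concern subtraction of `n - d`, `n` and `n + d`. As `d`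
and `n` are coprime, every integer has the form `k * d + h * n + x₀`, uniquely up to replacing
`(k, h)` by `(k + n, h - d)`. In these coordinates the set is the region on or below the graph of a
function `H : ℤ → ℤ`. The closure conditions say that `H` has steps in `{-1, 0, 1}`, the ambiguity of
the coordinates says that `H (k + n) = H k - d`, and for a suitable origin `x₀` the symmetry says
that `H (-δ - k) = -H k`, where `δ ∈ {0, 1}` is the parity of `n - 1` (`subgraph_bijOn`).

Such an `H` vanishes at `0` and is determined by its steps on `[0, m]`, where `m = ⌊(n - 1) / 2⌋`.
These are arbitrary except for the step that follows them, which leads from `H m` to `-d - H m`, so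
that `|2 * H m + d| ≤ 1` (`stepWord_bijOn`). Hence the partitions are equinumerous with the words of
length `m` in `1, 0, -1` whose sum `v` satisfies `|2 * v + d| ≤ 1`. For even `d` this forces
`v = -d / 2`, for odd `d` it allows `v = -(d - 1) / 2` and `v = -(d + 1) / 2`; sorting the words by
their letter frequencies gives the sums of trinomial coefficients.
-/

/-! ### Beta sets of partitions -/

namespace YoungDiagram

/-- The beta set (Maya diagram) of a partition with row lengths `λ₀ ≥ λ₁ ≥ ⋯`, padded by infinitely
many zero rows: the set of all integers `λ_i - i - 1`. -/
def betaSet (μ : YoungDiagram) : Set ℤ :=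
  Set.range fun i : ℕ => (μ.rowLen i : ℤ) - i - 1

theorem lt_rowLen_iff_lt_colLen (μ : YoungDiagram) (i j : ℕ) :
    j < μ.rowLen i ↔ i < μ.colLen j := by
  rw [← mem_iff_lt_rowLen, mem_iff_lt_colLen]

/-- The gaps of the beta set are read off from the columns, as its elements are from the rows. -/
theorem notMem_betaSet_iff (μ : YoungDiagram) (x : ℤ) :
    x ∉ μ.betaSet ↔ ∃ j : ℕ, x = j - μ.colLen j := by
  constructor
  · intro hx
    have hex : ∃ i : ℕ, (μ.rowLen i : ℤ) - i - 1 < x := by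
      refine ⟨(μ.rowLen 0 - x).toNat, ?_⟩
      have := μ.rowLen_anti 0 (μ.rowLen 0 - x).toNat (Nat.zero_le _)
      omega
    -- The column wanted is the one whose bottom box lies in the row just above the first row `i`
    -- that falls below `x`.
    classical
    obtain ⟨i, hi, hmin⟩ : ∃ i : ℕ, (μ.rowLen i : ℤ) - i - 1 < x ∧
        ∀ k < i, ¬ (μ.rowLen k : ℤ) - k - 1 < x :=
      ⟨Nat.find hex, Nat.find_spec hex, fun k hk => Nat.find_min hex hk⟩
    refine ⟨(x + i).toNat, ?_⟩
    have h1 : μ.colLen (x + i).toNat ≤ i := by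
      by_contra h
      have := (μ.lt_rowLen_iff_lt_colLen i (x + i).toNat).2 (by omega)
      omega
    have h2 : i ≤ μ.colLen (x + i).toNat := by
      rcases i with _ | i
      · omega
      · have h3 := hmin i (by omega)
        have h4 : (μ.rowLen i : ℤ) - i - 1 ≠ x := fun h => hx ⟨i, h⟩
        have := (μ.lt_rowLen_iff_lt_colLen i (x + (i + 1 : ℕ)).toNat).1 (by omega)
        omega
    omega
  · rintro ⟨j, rfl⟩ ⟨i, hi⟩
    have := μ.lt_rowLen_iff_lt_colLen i j
    simp only at hi
    omega

/-- Hook lengths are the differences `x - y > 0` with `x` in the beta set and `y` outside it, so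
a `t`-core is a partition whose beta set is closed under subtracting `t`. -/
theorem isCore_iff (μ : YoungDiagram) {t : ℕ} (ht : 0 < t) :
    μ.IsCore t ↔ ∀ x ∈ μ.betaSet, x - t ∈ μ.betaSet := by
  constructor
  · rintro h _ ⟨i, rfl⟩
    by_contra hy
    obtain ⟨j, hj⟩ := (μ.notMem_betaSet_iff _).1 hy
    have h1 := μ.lt_rowLen_iff_lt_colLen i j
    simp only at hj
    refine h i j (mem_iff_lt_rowLen.2 (by omega)) ?_
    unfold hookLength
    omega
  · intro h i j hij hook
    have h1 := mem_iff_lt_rowLen.1 hij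
    have h2 := mem_iff_lt_colLen.1 hij
    refine (μ.notMem_betaSet_iff ((μ.rowLen i : ℤ) - i - 1 - t)).2 ⟨j, ?_⟩ (h _ ⟨i, rfl⟩)
    unfold hookLength at hook
    omega

theorem betaSet_injective : Function.Injective betaSet := by
  intro μ ν h
  have anti : ∀ κ : YoungDiagram, StrictAnti fun i : ℕ => (κ.rowLen i : ℤ) - i - 1 := by
    intro κ i j hij
    have := κ.rowLen_anti i j hij.le
    simp only
    omega
  have h1 : (fun i : ℕ => OrderDual.toDual ((μ.rowLen i : ℤ) - i - 1)) =
      fun i : ℕ => OrderDual.toDual ((ν.rowLen i : ℤ) - i - 1) :=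
    ((anti μ).dual_right.range_inj (anti ν).dual_right).1 h
  ext ⟨i, j⟩
  have h2 : (μ.rowLen i : ℤ) - i - 1 = (ν.rowLen i : ℤ) - i - 1 := congrFun h1 i
  rw [mem_cells, mem_cells, mem_iff_lt_rowLen, mem_iff_lt_rowLen]
  omega

theorem mem_betaSet_transpose (μ : YoungDiagram) (x : ℤ) :
    x ∈ μ.transpose.betaSet ↔ -1 - x ∉ μ.betaSet := by
  rw [notMem_betaSet_iff]
  simp only [betaSet, Set.mem_range, rowLen_transpose]
  exact exists_congr fun i => by omega

theorem isSelfConjugate_iff (μ : YoungDiagram) :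
    μ.IsSelfConjugate ↔ ∀ x, x ∈ μ.betaSet ↔ -1 - x ∉ μ.betaSet := by
  rw [IsSelfConjugate, ← betaSet_injective.eq_iff, Set.ext_iff]
  simp only [mem_betaSet_transpose]
  exact forall_congr' fun x => Iff.comm

/-- An integer set that is symmetric in the sense of self-conjugate partitions and bounded above
is a beta set: by symmetry it contains exactly half of `[-N, N)`, so it has charge zero. -/
theorem exists_betaSet_eq {S : Set ℤ} (hS : ∀ x, x ∈ S ↔ -1 - x ∉ S) {N : ℕ}
    (hN : ∀ x : ℤ, N ≤ x → x ∉ S) : ∃ μ : YoungDiagram, μ.betaSet = S := by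
  classical
  let T : ℕ → Prop := fun k => (N : ℤ) - 1 - k ∈ S
  have hT : ∀ k, 2 * N ≤ k → T k := fun k hk => (hS _).2 (hN _ (by omega))
  have hinf : (Set.ofPred T).Infinite :=
    Set.infinite_of_not_bddAbove fun ⟨b, hb⟩ => by
      have := hb (show b + 2 * N + 1 ∈ Set.ofPred T from hT _ (by omega))
      omega
  have hcount : Nat.count T (2 * N) = N := by
    -- `k ↦ 2N - 1 - k` exchanges the elements and the gaps.
    have h1 : ((Finset.range (2 * N)).filter T).card =
        ((Finset.range (2 * N)).filter fun k => ¬ T k).card := by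
      have key : ∀ k < 2 * N, (T (2 * N - 1 - k) ↔ ¬ T k) := fun k hk => by
        simp only [T]
        rw [hS]
        have : (-1 - ((N : ℤ) - 1 - ((2 * N - 1 - k : ℕ) : ℤ))) = N - 1 - k := by omega
        rw [this]
      refine Finset.card_nbij' (fun k => 2 * N - 1 - k) (fun k => 2 * N - 1 - k) ?_ ?_ ?_ ?_
      · intro k hk
        simp only [Finset.coe_filter, Finset.mem_range, Set.mem_ofPred_eq] at hk ⊢
        exact ⟨by omega, fun h => (key k hk.1).1 h hk.2⟩
      · intro k hk
        simp only [Finset.coe_filter, Finset.mem_range, Set.mem_ofPred_eq] at hk ⊢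
        exact ⟨by omega, (key k hk.1).2 hk.2⟩
      · intro k hk
        simp only [Finset.coe_filter, Finset.mem_range, Set.mem_ofPred_eq] at hk ⊢
        omega
      · intro k hk
        simp only [Finset.coe_filter, Finset.mem_range, Set.mem_ofPred_eq] at hk ⊢
        omega
    have h2 : ((Finset.range (2 * N)).filter T).card +
        ((Finset.range (2 * N)).filter fun k => ¬ T k).card = 2 * N := by
      rw [Finset.card_filter_add_card_filter_not, Finset.card_range]
    have h3 : ((Finset.range (2 * N)).filter T).card = N := by omega
    rw [Nat.count_eq_card_filter_range]
    exact h3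
  have hmono : StrictMono (Nat.nth T) := Nat.nth_strictMono hinf
  have htail : ∀ k, Nat.nth T (N + k) = 2 * N + k := by
    intro k
    have h1 : Nat.count T (2 * N + k) = N + k := by
      induction k with
      | zero => exact hcount
      | succ k ih => rw [← add_assoc, Nat.count_succ, ih, if_pos (hT _ (by omega)), add_assoc]
    rw [← h1]
    exact Nat.nth_count (hT _ (by omega))
  have hstep : ∀ i k, Nat.nth T i + k ≤ Nat.nth T (i + k) := fun i k => by
    rw [add_comm, add_comm i]
    exact hmono.add_le_nat k i
  have hle : ∀ i, Nat.nth T i ≤ N + i := fun i => by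
    have h1 := hstep i N
    rw [add_comm i N, htail] at h1
    omega
  have hge : ∀ i, i ≤ Nat.nth T i := fun i => hmono.le_apply
  -- Row `i` has length `N + i - nth T i`, which vanishes from row `N` on.
  let μ : YoungDiagram :=
    { cells := (Finset.range N ×ˢ Finset.range N).filter fun c => c.2 + Nat.nth T c.1 < N + c.1
      isLowerSet := by
        rintro ⟨i, j⟩ ⟨i', j'⟩ ⟨hi, hj⟩ h
        simp only [Finset.coe_filter, Finset.mem_product, Finset.mem_range,
          Set.mem_ofPred_eq] at h hi hj ⊢
        have h1 := hstep i' (i - i')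
        rw [Nat.add_sub_cancel' hi] at h1
        omega }
  have hrow : ∀ i, μ.rowLen i = N + i - Nat.nth T i := by
    intro i
    have h1 : ∀ j, j < μ.rowLen i ↔ j < N + i - Nat.nth T i := by
      intro j
      rw [← mem_iff_lt_rowLen, ← mem_cells]
      simp only [μ, Finset.mem_filter, Finset.mem_product, Finset.mem_range]
      have := hge i
      rcases lt_or_ge i N with hi | hi
      · omega
      · have h2 := htail (i - N)
        rw [Nat.add_sub_cancel' hi] at h2
        omega
    have h2 := h1 (μ.rowLen i)
    have h3 := h1 (N + i - Nat.nth T i)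
    omega
  refine ⟨μ, Set.ext fun x => ?_⟩
  simp only [betaSet, Set.mem_range, hrow]
  constructor
  · rintro ⟨i, rfl⟩
    have h1 : T (Nat.nth T i) := Nat.nth_mem_of_infinite hinf i
    have h2 := hle i
    have h3 : (((N + i - Nat.nth T i : ℕ) : ℤ) - i - 1) = N - 1 - (Nat.nth T i : ℕ) := by omega
    rw [h3]
    exact h1
  · intro hx
    have hxN : x < N := by
      by_contra h
      exact hN x (by omega) hx
    have h1 : T (N - 1 - x).toNat := by
      have h2 : (N : ℤ) - 1 - ((N - 1 - x).toNat : ℕ) = x := by omega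
      simpa only [T, h2] using hx
    refine ⟨Nat.count T (N - 1 - x).toNat, ?_⟩
    have h2 := hle (Nat.count T (N - 1 - x).toNat)
    rw [Nat.nth_count h1] at h2 ⊢
    omega

end YoungDiagram

/-! ### Counting words by letter frequencies -/

open Finset in
/-- Words with prescribed letter frequencies are counted by multinomial coefficients: compare
coefficients in the two expansions of the `m`-th power of a sum of variables. -/
theorem card_words_of_count {α : Type*} [Fintype α] [DecidableEq α] (m : ℕ) (k : α → ℕ)
    (hk : ∑ a, k a = m) :
    #{w : Fin m → α | ∀ a, #{i | w i = a} = k a} = Nat.multinomial univ k := by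
  have h := MvPolynomial.coeff_sum_X_pow_of_fintype (R := ℕ) (Finsupp.equivFunOnFinite.symm k) m
  rw [if_pos (by rw [Finsupp.sum_fintype _ _ (fun _ => rfl)]; simpa using hk),
    Finsupp.multinomial_eq_of_support_subset (subset_univ _), Fintype.sum_pow,
    MvPolynomial.coeff_sum] at h
  simp only [Finsupp.coe_equivFunOnFinite_symm, Nat.cast_id] at h
  rw [← h, card_filter]
  refine sum_congr rfl fun w _ => ?_
  have h1 : ∏ i, (MvPolynomial.X (w i) : MvPolynomial α ℕ) =
      MvPolynomial.monomial (∑ i, Finsupp.single (w i) 1) 1 := by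
    simp only [MvPolynomial.X]
    rw [← MvPolynomial.monomial_sum_one]
  rw [h1, MvPolynomial.coeff_monomial]
  refine if_congr ?_ rfl rfl
  rw [Finsupp.ext_iff]
  refine forall_congr' fun a => ?_
  rw [Finsupp.finsetSum_apply]
  simp only [Finsupp.single_apply, card_filter, Finsupp.equivFunOnFinite_symm_apply_apply]

open Finset in
theorem card_count_add {m : ℕ} (w : Fin m → SignType) :
    #{i | w i = 1} + #{i | w i = -1} + #{i | w i = 0} = m := by
  have h := card_eq_sum_card_fiberwise (f := w) (s := univ) (t := univ) (by simp)
  rw [SignType.univ_eq] at h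
  simp only [card_univ, Fintype.card_fin] at h
  rw [sum_insert (by decide), sum_insert (by decide), sum_singleton] at h
  omega

open Finset in
/-- This includes the case `a + b + c ≠ m`, where both sides vanish. -/
theorem trinomial_eq_card (m a b c : ℕ) :
    trinomial m a b c = #{w : Fin m → SignType |
      #{i | w i = 1} = a ∧ #{i | w i = -1} = b ∧ #{i | w i = 0} = c} := by
  unfold trinomial
  split_ifs with habc
  · let k : SignType → ℕ := fun x => if x = 1 then a else if x = -1 then b else c
    have huniv : ∀ f : SignType → ℕ, ∑ x, f x = f 1 + f (-1) + f 0 := by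
      intro f
      rw [SignType.univ_eq, sum_insert (by decide), sum_insert (by decide), sum_singleton]
      ring
    have hprod : ∀ f : SignType → ℕ, ∏ x, f x = f 1 * f (-1) * f 0 := by
      intro f
      rw [SignType.univ_eq, prod_insert (by decide), prod_insert (by decide), prod_singleton]
      ring
    have h1 : k 1 = a := rfl
    have h2 : k (-1) = b := rfl
    have h3 : k 0 = c := rfl
    have h4 : Nat.multinomial univ ![a, b, c] = Nat.multinomial univ k := by
      simp only [Nat.multinomial, huniv, hprod, h1, h2, h3, Fin.sum_univ_three,
        Fin.prod_univ_three]
      rfl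
    rw [h4, ← card_words_of_count m k (by rw [huniv, h1, h2, h3, habc])]
    congr 1
    ext w
    simp only [mem_filter, mem_univ, true_and]
    constructor
    · exact fun h => ⟨h 1, h (-1), h 0⟩
    · rintro ⟨ha, hb, hc⟩ x
      rcases x with _ | _ | _
      exacts [hc, hb, ha]
  · symm
    rw [card_eq_zero, filter_eq_empty_iff]
    rintro w - ⟨rfl, rfl, rfl⟩
    exact habc (card_count_add w)

open Finset in
theorem sum_word_eq {m : ℕ} (w : Fin m → SignType) :
    ∑ i, (w i : ℤ) = #{i | w i = 1} - #{i | w i = -1} := by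
  rw [card_filter, card_filter]
  push_cast
  rw [← sum_sub_distrib]
  refine sum_congr rfl fun i _ => ?_
  cases w i <;> decide

open Finset in
/-- For even `d`, an admissible word is classified by its number of up steps. -/
theorem card_words_of_even {s d : ℕ} (hs : 0 < s) (hsd : Nat.Coprime s d) (hd : Even d) :
    #{w : Fin ((s + d - 1) / 2) → SignType | |2 * ∑ i, (w i : ℤ) + d| ≤ 1} =
      ∑ i ∈ range (s / 4 + 1),
        trinomial ((s + d - 1) / 2) i (d / 2 + i) ((s - 1) / 2 - 2 * i) := by
  obtain ⟨e, rfl⟩ := hd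
  have hodd : s % 2 = 1 := by
    by_contra h
    have h1 : 2 ∣ Nat.gcd s (e + e) := Nat.dvd_gcd (by omega) (by omega)
    rw [hsd] at h1
    omega
  have key : ∀ w : Fin ((s + (e + e) - 1) / 2) → SignType,
      |2 * ∑ i, (w i : ℤ) + (e + e : ℕ)| ≤ 1 ↔
        #{i | w i = -1} = #{i | w i = 1} + e := by
    intro w
    rw [sum_word_eq, abs_le]
    push_cast
    omega
  rw [card_eq_sum_card_fiberwise (f := fun w => #{i | w i = 1}) (t := range (s / 4 + 1))]
  · refine sum_congr rfl fun i hi => ?_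
    rw [trinomial_eq_card, filter_filter]
    congr 1
    refine filter_congr fun w _ => ?_
    rw [key]
    have := card_count_add w
    have := mem_range.1 hi
    omega
  · intro w hw
    simp only [coe_filter, mem_univ, true_and, Set.mem_ofPred_eq, key, coe_range,
      Set.mem_Iio] at hw ⊢
    have := card_count_add w
    omega

open Finset in
/-- For odd `d`, an admissible word is classified by its number of level steps. -/
theorem card_words_of_odd {s d : ℕ} (hs : 0 < s) (hd : Odd d) :
    #{w : Fin ((s + d - 1) / 2) → SignType | |2 * ∑ i, (w i : ℤ) + d| ≤ 1} =
      ∑ i ∈ range (s / 2 + 1),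
        trinomial ((s + d - 1) / 2) (i / 2) ((d + i) / 2) (s / 2 - i) := by
  obtain ⟨e, rfl⟩ := hd
  have key : ∀ w : Fin ((s + (2 * e + 1) - 1) / 2) → SignType,
      |2 * ∑ i, (w i : ℤ) + (2 * e + 1 : ℕ)| ≤ 1 ↔
        #{i | w i = -1} = #{i | w i = 1} + e ∨ #{i | w i = -1} = #{i | w i = 1} + e + 1 := by
    intro w
    rw [sum_word_eq, abs_le]
    push_cast
    omega
  rw [card_eq_sum_card_fiberwise (f := fun w => s / 2 - #{i | w i = 0}) (t := range (s / 2 + 1))]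
  · refine sum_congr rfl fun i hi => ?_
    rw [trinomial_eq_card, filter_filter]
    congr 1
    refine filter_congr fun w _ => ?_
    rw [key]
    have := card_count_add w
    have := mem_range.1 hi
    omega
  · intro w hw
    simp only [coe_range, Set.mem_Iio]
    omega

/-! ### Symmetric core sets and periodic paths -/

/-- The sets of integers that are symmetric like the beta set of a self-conjugate partition and
closed under subtracting `n - d`, `n` and `n + d`. -/
def symmetricCoreSets (n d : ℤ) : Set (Set ℤ) :=
  {S | (∀ x, x ∈ S ↔ -1 - x ∉ S) ∧
    (∀ x ∈ S, x - (n - d) ∈ S) ∧ (∀ x ∈ S, x - n ∈ S) ∧ ∀ x ∈ S, x - (n + d) ∈ S}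

/-- The bi-infinite Motzkin paths of heights `H k`, with steps in `{-1, 0, 1}`, that fall by `d`
in every period of length `n` and are odd under the reflection `k ↦ -δ - k`. -/
def oddPeriodicPaths (n d δ : ℤ) : Set (ℤ → ℤ) :=
  {H | (∀ k, H (k + n) = H k - d) ∧ (∀ k, H (-δ - k) = -H k) ∧ ∀ k, |H (k + 1) - H k| ≤ 1}

/-- The integers `k * d + h * n + x₀` with `(k, h)` on or below the path `H`. -/
def subgraph (n d x₀ : ℤ) (H : ℤ → ℤ) : Set ℤ :=
  {x | ∃ k h, x = k * d + h * n + x₀ ∧ h ≤ H k}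

theorem add_period_mul {n d : ℤ} {H : ℤ → ℤ} (hH : ∀ k, H (k + n) = H k - d) (k q : ℤ) :
    H (k + n * q) = H k - q * d := by
  induction q using Int.induction_on with
  | zero => simp
  | succ q ih => rw [mul_add, mul_one, ← add_assoc, hH, ih]; ring
  | pred q ih =>
    have h := hH (k + n * (-q - 1))
    have h1 : k + n * (-(q : ℤ) - 1) + n = k + n * -q := by ring
    rw [h1, ih] at h
    linarith

/-- The points `(k, h)` naming the same integer differ by multiples of `(n, -d)`, so a path with
the right periodicity is recovered from its subgraph. -/
theorem mem_subgraph_iff {n d x₀ : ℤ} (hn : n ≠ 0) (hnd : IsCoprime d n) {H : ℤ → ℤ}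
    (hH : ∀ k, H (k + n) = H k - d) (k h : ℤ) :
    k * d + h * n + x₀ ∈ subgraph n d x₀ H ↔ h ≤ H k := by
  constructor
  · rintro ⟨k', h', he, hle⟩
    have h1 : n ∣ (k' - k) * d := ⟨h - h', by linear_combination -he⟩
    obtain ⟨q, hq⟩ := hnd.symm.dvd_of_dvd_mul_right h1
    have h2 : h - h' = q * d := by
      apply mul_left_cancel₀ hn
      linear_combination he + d * hq
    have h3 : k' = k + n * q := by linear_combination hq
    rw [h3, add_period_mul hH] at hle
    linarith
  · exact fun hle => ⟨k, h, rfl, hle⟩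

/-- Coordinates `(k, h)` of an integer, with `k` in the period `[0, n)`. -/
theorem exists_coords {n d : ℤ} (hn : 0 < n) (hnd : IsCoprime d n) (x₀ x : ℤ) :
    ∃ k h, x = k * d + h * n + x₀ ∧ 0 ≤ k ∧ k < n := by
  obtain ⟨u, v, huv⟩ := hnd
  have h1 := Int.emod_add_mul_ediv (u * (x - x₀)) n
  refine ⟨u * (x - x₀) % n, v * (x - x₀) + (u * (x - x₀) / n) * d, ?_,
    Int.emod_nonneg _ hn.ne', Int.emod_lt_of_pos _ hn⟩
  linear_combination (-(x - x₀)) * huv - d * h1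

theorem path_zero {n d δ : ℤ} (hδ : δ = 0 ∨ δ = 1) {H : ℤ → ℤ}
    (hH : H ∈ oddPeriodicPaths n d δ) : H 0 = 0 := by
  obtain ⟨-, h2, h3⟩ := hH
  rcases hδ with rfl | rfl
  · have := h2 0
    norm_num at this
    omega
  · have h4 := h2 0
    have h5 := h3 (-1)
    norm_num at h4 h5
    rw [h4, abs_le] at h5
    omega

theorem subgraph_mem_symmetricCoreSets {n d δ x₀ : ℤ} (hn : 0 < n) (hnd : IsCoprime d n)
    (hx₀ : 2 * x₀ + 1 = δ * d - n) {H : ℤ → ℤ} (hH : H ∈ oddPeriodicPaths n d δ) :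
    subgraph n d x₀ H ∈ symmetricCoreSets n d := by
  obtain ⟨h1, h2, h3⟩ := hH
  have hmem := fun k h => mem_subgraph_iff (x₀ := x₀) hn.ne' hnd h1 k h
  refine ⟨fun x => ?_, ?_, ?_, ?_⟩
  · obtain ⟨k, h, rfl, -⟩ := exists_coords hn hnd x₀ x
    have he : -1 - (k * d + h * n + x₀) = (-δ - k) * d + (1 - h) * n + x₀ := by
      linear_combination -hx₀
    rw [he, hmem, hmem, h2]
    omega
  · rintro _ ⟨k, h, rfl, hle⟩
    have := abs_le.1 (h3 k)
    exact ⟨k + 1, h - 1, by ring, by omega⟩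
  · rintro _ ⟨k, h, rfl, hle⟩
    exact ⟨k, h - 1, by ring, by omega⟩
  · rintro _ ⟨k, h, rfl, hle⟩
    have := abs_le.1 (h3 (k - 1))
    rw [sub_add_cancel] at this
    exact ⟨k - 1, h - 1, by ring, by omega⟩

theorem subgraph_injOn {n d δ x₀ : ℤ} (hn : 0 < n) (hnd : IsCoprime d n) :
    Set.InjOn (subgraph n d x₀) (oddPeriodicPaths n d δ) := by
  intro H hH H' hH' he
  funext k
  have h : ∀ h, h ≤ H k ↔ h ≤ H' k := fun h => by
    rw [← mem_subgraph_iff (x₀ := x₀) hn.ne' hnd hH.1, he,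
      mem_subgraph_iff hn.ne' hnd hH'.1]
  exact le_antisymm ((h _).1 le_rfl) ((h _).2 le_rfl)

/-- The path of a set `S` has height `max {h | k * d + h * n + x₀ ∈ S}` at `k`. The maximum exists,
because the symmetry pins the path to height `0` at `k = 0`, and the steps are bounded. -/
theorem exists_subgraph_eq {n d δ x₀ : ℤ} (hn : 0 < n) (hnd : IsCoprime d n)
    (hδ : δ = 0 ∨ δ = 1) (hx₀ : 2 * x₀ + 1 = δ * d - n) {S : Set ℤ}
    (hS : S ∈ symmetricCoreSets n d) : ∃ H ∈ oddPeriodicPaths n d δ, subgraph n d x₀ H = S := by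
  obtain ⟨hsym, hs₁, hs₂, hs₃⟩ := hS
  let U : ℤ → ℤ → Prop := fun k h => k * d + h * n + x₀ ∈ S
  have hU : ∀ {k h k' h' : ℤ}, U k h → k' * d + h' * n = k * d + h * n → U k' h' := by
    intro k h k' h' hu he
    simp only [U, he]
    exact hu
  have usym : ∀ k h, U k h ↔ ¬ U (-δ - k) (1 - h) := by
    intro k h
    have he : -1 - (k * d + h * n + x₀) = (-δ - k) * d + (1 - h) * n + x₀ := by
      linear_combination -hx₀
    simp only [U]
    rw [hsym, he]
  have uright : ∀ k h, U k h → U (k + 1) (h - 1) := fun k h hu => by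
    have he : (k + 1) * d + (h - 1) * n + x₀ = k * d + h * n + x₀ - (n - d) := by ring
    simpa only [U, he] using hs₁ _ hu
  have udown : ∀ k h, U k h → U k (h - 1) := fun k h hu => by
    have he : k * d + (h - 1) * n + x₀ = k * d + h * n + x₀ - n := by ring
    simpa only [U, he] using hs₂ _ hu
  have uleft : ∀ k h, U k h → U (k - 1) (h - 1) := fun k h hu => by
    have he : (k - 1) * d + (h - 1) * n + x₀ = k * d + h * n + x₀ - (n + d) := by ring
    simpa only [U, he] using hs₃ _ hu
  have udowns : ∀ k h (j : ℕ), U k h → U k (h - j) := by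
    intro k h j hu
    induction j with
    | zero => simpa using hu
    | succ j ih =>
      have := udown _ _ ih
      rwa [Nat.cast_succ, ← sub_sub]
  have ule : ∀ k h h', h' ≤ h → U k h → U k h' := by
    intro k h h' hle hu
    have := udowns k h (h - h').toNat hu
    rwa [Int.toNat_of_nonneg (by omega), sub_sub_cancel] at this
  have urights : ∀ k h (j : ℕ), U k h → U (k + j) (h - j) := by
    intro k h j hu
    induction j with
    | zero => simpa using hu
    | succ j ih =>
      have := uright _ _ ih
      rwa [Nat.cast_succ, ← sub_sub, ← add_assoc]
  have ulefts : ∀ k h (j : ℕ), U k h → U (k - j) (h - j) := by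
    intro k h j hu
    induction j with
    | zero => simpa using hu
    | succ j ih =>
      have := uleft _ _ ih
      rwa [Nat.cast_succ, ← sub_sub, ← sub_sub]
  have umove : ∀ k k' h, U k h → U k' (h - |k' - k|) := by
    intro k k' h hu
    rcases le_total k k' with hle | hle
    · have := urights k h (k' - k).toNat hu
      rw [Int.toNat_of_nonneg (by omega), add_sub_cancel] at this
      rwa [abs_of_nonneg (by omega)]
    · have := ulefts k h (k - k').toNat hu
      rw [Int.toNat_of_nonneg (by omega), sub_sub_cancel] at this
      rwa [abs_of_nonpos (by omega), neg_sub]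
  have u01 : ¬ U 0 1 := by
    intro hu
    have h1 := (usym 0 1).1 hu
    rcases hδ with rfl | rfl
    · exact h1 (by simpa using udown _ _ hu)
    · exact h1 (by simpa using uleft _ _ hu)
  have u00 : U 0 0 := by
    rw [usym]
    intro hu
    rcases hδ with rfl | rfl
    · exact u01 (by simpa using hu)
    · have h1 := uright _ _ hu
      have h2 := usym 0 0
      norm_num at h1 h2 hu
      exact h2.1 h1 hu
  have hmax : ∀ k, ∃ H, ∀ h, h ≤ H ↔ U k h := by
    intro k
    obtain ⟨H, hH, hub⟩ := Int.exists_greatest_of_bdd (P := U k)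
      ⟨|k|, fun h hu => by
        by_contra hlt
        refine u01 (ule 0 _ 1 ?_ (umove k 0 h hu))
        rw [zero_sub, abs_neg]
        omega⟩
      ⟨-|k|, by simpa using umove 0 k 0 u00⟩
    exact ⟨H, fun h => ⟨fun hle => ule k H h hle hH, hub h⟩⟩
  choose H hH using hmax
  have hper : ∀ k, H (k + n) = H k - d := by
    intro k
    have h1 : ∀ h, h ≤ H (k + n) ↔ h + d ≤ H k := fun h => by
      rw [hH, hH]
      exact ⟨fun hu => hU hu (by ring), fun hu => hU hu (by ring)⟩
    have h2 := h1 (H (k + n))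
    have h3 := h1 (H k - d)
    omega
  refine ⟨H, ⟨hper, fun k => ?_, fun k => ?_⟩, Set.ext fun x => ?_⟩
  · have h1 : ∀ h, h ≤ H k ↔ ¬ 1 - h ≤ H (-δ - k) := fun h => by rw [hH, hH, usym]
    have h2 := h1 (H k)
    have h3 := h1 (H k + 1)
    omega
  · have h1 := (hH (k + 1) _).2 (uright _ _ ((hH k (H k)).1 le_rfl))
    have h2 := (hH (k + 1 - 1) _).2 (uleft _ _ ((hH (k + 1) (H (k + 1))).1 le_rfl))
    rw [add_sub_cancel_right] at h2
    rw [abs_le]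
    omega
  · obtain ⟨k, h, rfl, -⟩ := exists_coords hn hnd x₀ x
    rw [mem_subgraph_iff hn.ne' hnd hper, hH]

theorem subgraph_bijOn {n d δ x₀ : ℤ} (hn : 0 < n) (hnd : IsCoprime d n)
    (hδ : δ = 0 ∨ δ = 1) (hx₀ : 2 * x₀ + 1 = δ * d - n) :
    Set.BijOn (subgraph n d x₀) (oddPeriodicPaths n d δ) (symmetricCoreSets n d) :=
  ⟨fun _ hH => subgraph_mem_symmetricCoreSets hn hnd hx₀ hH, subgraph_injOn hn hnd,
    fun _ hS => exists_subgraph_eq hn hnd hδ hx₀ hS⟩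

theorem abs_path_le {n d δ : ℤ} (hδ : δ = 0 ∨ δ = 1) {H : ℤ → ℤ}
    (hH : H ∈ oddPeriodicPaths n d δ) (k : ℕ) : |H k| ≤ k := by
  induction k with
  | zero => simp [path_zero hδ hH]
  | succ k ih =>
    have h1 := abs_le.1 ih
    have h2 := abs_le.1 (hH.2.2 k)
    push_cast
    rw [abs_le]
    omega

theorem bddAbove_subgraph {n d δ x₀ : ℤ} (hn : 0 < n) (hd : 0 < d) (hnd : IsCoprime d n)
    (hδ : δ = 0 ∨ δ = 1) {H : ℤ → ℤ} (hH : H ∈ oddPeriodicPaths n d δ) :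
    ∃ N : ℕ, ∀ x : ℤ, N ≤ x → x ∉ subgraph n d x₀ H := by
  refine ⟨(n * d + n * n + x₀ + 1).toNat, fun x hx hmem => ?_⟩
  obtain ⟨k, h, rfl, hk0, hkn⟩ := exists_coords hn hnd x₀ x
  rw [mem_subgraph_iff hn.ne' hnd hH.1] at hmem
  have h1 := abs_le.1 (abs_path_le hδ hH k.toNat)
  rw [Int.toNat_of_nonneg hk0] at h1
  have h2 : k * d ≤ n * d := mul_le_mul_of_nonneg_right hkn.le hd.le
  have h3 : h * n ≤ n * n := mul_le_mul_of_nonneg_right (by omega) hn.le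
  omega

/-! ### Periodic paths and their step words -/

theorem coe_sign_of_abs_le_one {b : ℤ} (hb : |b| ≤ 1) : ((SignType.sign b : SignType) : ℤ) = b := by
  obtain ⟨h1, h2⟩ := abs_le.1 hb
  obtain rfl | rfl | rfl : b = -1 ∨ b = 0 ∨ b = 1 := by omega
  all_goals decide

/-- The steps of a path from `0` to `m`. -/
noncomputable def stepWord (m : ℕ) (H : ℤ → ℤ) : Fin m → SignType :=
  fun i => SignType.sign (H (i + 1) - H i)

/-- The height reached after the first `k` steps of a word. -/
def partialSum {m : ℕ} (w : Fin m → SignType) (k : ℕ) : ℤ :=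
  ∑ i ∈ Finset.range k, if h : i < m then (w ⟨i, h⟩ : ℤ) else 0

theorem partialSum_self {m : ℕ} (w : Fin m → SignType) : partialSum w m = ∑ i, (w i : ℤ) := by
  rw [partialSum, ← Fin.sum_univ_eq_sum_range (fun i => if h : i < m then (w ⟨i, h⟩ : ℤ) else 0)]
  simp

theorem partialSum_succ {m : ℕ} (w : Fin m → SignType) {k : ℕ} (hk : k < m) :
    partialSum w (k + 1) = partialSum w k + w ⟨k, hk⟩ := by
  rw [partialSum, Finset.sum_range_succ, dif_pos hk]
  rfl

theorem abs_partialSum_succ_sub {m : ℕ} (w : Fin m → SignType) (k : ℕ) :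
    |partialSum w (k + 1) - partialSum w k| ≤ 1 := by
  rw [partialSum, Finset.sum_range_succ, partialSum, add_sub_cancel_left]
  split_ifs with h
  · cases w ⟨k, h⟩ <;> decide
  · decide

theorem eq_partialSum_stepWord {n d δ : ℤ} (hδ : δ = 0 ∨ δ = 1) {H : ℤ → ℤ}
    (hH : H ∈ oddPeriodicPaths n d δ) {m k : ℕ} (hk : k ≤ m) :
    H k = partialSum (stepWord m H) k := by
  induction k with
  | zero => simpa [partialSum] using path_zero hδ hH
  | succ k ih =>
    rw [partialSum_succ _ (by omega), ← ih (by omega), stepWord, coe_sign_of_abs_le_one (hH.2.2 k)]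
    push_cast
    ring

/-- The `n = 2 * m + 1 + δ` integers of `[-δ - m, m]` represent all residues modulo `n`. -/
theorem exists_eq_add_period_mul {n δ : ℤ} {m : ℕ} (hδ : δ = 0 ∨ δ = 1) (hn : n = 2 * m + 1 + δ)
    (k : ℤ) : ∃ r q, k = r + n * q ∧ -δ - m ≤ r ∧ r ≤ m := by
  have h1 := Int.emod_add_mul_ediv (k + m + δ) n
  have h2 := Int.emod_nonneg (k + m + δ) (b := n) (by omega)
  have h3 := Int.emod_lt_of_pos (k + m + δ) (b := n) (by omega)
  exact ⟨(k + m + δ) % n - (m + δ), (k + m + δ) / n, by linarith, by omega, by omega⟩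

/-- The step across the end of the fundamental domain `[-δ - m, m]` leads from height `H m` to
`H (m + 1) = -d - H m`; this is the only constraint on the word. -/
theorem stepWord_mem {n d δ : ℤ} {m : ℕ} (hδ : δ = 0 ∨ δ = 1) (hn : n = 2 * m + 1 + δ)
    {H : ℤ → ℤ} (hH : H ∈ oddPeriodicPaths n d δ) :
    |2 * ∑ i, (stepWord m H i : ℤ) + d| ≤ 1 := by
  rw [← partialSum_self, ← eq_partialSum_stepWord hδ hH le_rfl]
  have h1 := hH.2.1 (m + 1)
  have h2 := hH.1 (-δ - (m + 1))
  have h3 := hH.2.2 m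
  rw [show -δ - ((m : ℤ) + 1) + n = m by omega] at h2
  rw [abs_le] at h3 ⊢
  omega

theorem stepWord_injOn {n d δ : ℤ} {m : ℕ} (hδ : δ = 0 ∨ δ = 1) (hn : n = 2 * m + 1 + δ) :
    Set.InjOn (stepWord m) (oddPeriodicPaths n d δ) := by
  intro H hH H' hH' he
  have h1 : ∀ k : ℕ, k ≤ m → H k = H' k := fun k hk => by
    rw [eq_partialSum_stepWord hδ hH hk, eq_partialSum_stepWord hδ hH' hk, he]
  have h2 : ∀ r : ℤ, 0 ≤ r → r ≤ m → H r = H' r := fun r hr0 hrm => by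
    have := h1 r.toNat (by omega)
    rwa [Int.toNat_of_nonneg hr0] at this
  funext k
  obtain ⟨r, q, rfl, hr1, hr2⟩ := exists_eq_add_period_mul hδ hn k
  rw [add_period_mul hH.1, add_period_mul hH'.1]
  congr 1
  rcases le_or_gt 0 r with hr | hr
  · exact h2 r hr hr2
  · have h3 := h2 (-δ - r) (by omega) (by omega)
    rw [hH.2.1, hH'.2.1] at h3
    exact neg_injective h3

/-- A word with admissible final height is continued to a path, by reflection to `[-δ - m, m]` and
then by periodicity. -/
theorem exists_stepWord_eq {n d δ : ℤ} {m : ℕ} (hδ : δ = 0 ∨ δ = 1) (hn : n = 2 * m + 1 + δ)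
    {w : Fin m → SignType} (hw : |2 * ∑ i, (w i : ℤ) + d| ≤ 1) :
    ∃ H ∈ oddPeriodicPaths n d δ, stepWord m H = w := by
  have hP0 : partialSum w 0 = 0 := rfl
  let G : ℤ → ℤ := fun r => if 0 ≤ r then partialSum w r.toNat else -partialSum w (-δ - r).toNat
  have hG : ∀ k : ℕ, G k = partialSum w k := fun k => by simp [G]
  have hG_neg : ∀ k : ℕ, G (-δ - k) = -partialSum w k := fun k => by
    by_cases h : 0 ≤ -δ - (k : ℤ)
    · have h1 : δ = 0 := by omega
      have h2 : k = 0 := by omega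
      subst h1 h2
      simp [G, hP0]
    · simp only [G, if_neg h]
      congr 2
      omega
  have hsplit : ∀ r, -δ - m ≤ r → r ≤ m → ∃ k : ℕ, k ≤ m ∧ (r = k ∨ r = -δ - k) := by
    intro r h1 h2
    rcases le_or_gt 0 r with hr | hr
    · exact ⟨r.toNat, by omega, by omega⟩
    · exact ⟨(-δ - r).toNat, by omega, by omega⟩
  have hG_odd : ∀ r, -δ - m ≤ r → r ≤ m → G (-δ - r) = -G r := by
    intro r h1 h2
    obtain ⟨k, -, rfl | rfl⟩ := hsplit r h1 h2
    · rw [hG, hG_neg]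
    · rw [sub_sub_cancel, hG, hG_neg, neg_neg]
  have hG_step : ∀ r, -δ - m ≤ r → r < m → |G (r + 1) - G r| ≤ 1 := by
    intro r h1 h2
    obtain ⟨k, hk, rfl | rfl⟩ := hsplit r h1 h2.le
    · have := abs_partialSum_succ_sub w k
      rwa [hG, ← Nat.cast_succ, hG]
    · rcases k with _ | k
      · have h3 : G (-δ - (0 : ℕ) + 1) = partialSum w (1 - δ).toNat := by
          rw [← hG]
          congr 1
          omega
        rw [h3, hG_neg, hP0]
        rcases hδ with rfl | rfl
        · simpa [hP0] using abs_partialSum_succ_sub w 0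
        · simp [hP0]
      · have h3 : -δ - ((k + 1 : ℕ) : ℤ) + 1 = -δ - k := by
          push_cast
          ring
        rw [h3, hG_neg, hG_neg, neg_sub_neg]
        exact abs_partialSum_succ_sub w k
  let H : ℤ → ℤ := fun k => G ((k + m + δ) % n - (m + δ)) - (k + m + δ) / n * d
  have hH : ∀ r q, -δ - m ≤ r → r ≤ m → H (r + n * q) = G r - q * d := by
    intro r q h1 h2
    have h3 : r + n * q + m + δ = (r + m + δ) + n * q := by ring
    simp only [H]
    rw [h3, Int.add_mul_emod_self_left, Int.add_mul_ediv_left _ _ (by omega),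
      Int.emod_eq_of_lt (by omega) (by omega), Int.ediv_eq_zero_of_lt (by omega) (by omega)]
    congr 2 <;> ring
  have hH0 : ∀ k : ℕ, k ≤ m → H k = partialSum w k := fun k hk => by
    have := hH k 0 (by omega) (by omega)
    rwa [mul_zero, add_zero, zero_mul, sub_zero, hG] at this
  refine ⟨H, ⟨fun k => ?_, fun k => ?_, fun k => ?_⟩, ?_⟩
  · obtain ⟨r, q, rfl, h1, h2⟩ := exists_eq_add_period_mul hδ hn k
    have h3 : r + n * q + n = r + n * (q + 1) := by ring
    rw [h3, hH _ _ h1 h2, hH _ _ h1 h2]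
    ring
  · obtain ⟨r, q, rfl, h1, h2⟩ := exists_eq_add_period_mul hδ hn k
    have h3 : -δ - (r + n * q) = (-δ - r) + n * (-q) := by ring
    rw [h3, hH _ _ (by omega) (by omega), hH _ _ h1 h2, hG_odd r h1 h2]
    ring
  · obtain ⟨r, q, rfl, h1, h2⟩ := exists_eq_add_period_mul hδ hn k
    rcases h2.lt_or_eq with h2 | rfl
    · have h3 : r + n * q + 1 = (r + 1) + n * q := by ring
      rw [h3, hH _ _ (by omega) (by omega), hH _ _ h1 h2.le, sub_sub_sub_cancel_right]
      exact hG_step r h1 h2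
    · have h3 : (m : ℤ) + n * q + 1 = (-δ - m) + n * (q + 1) := by rw [hn]; ring
      have h4 : -(∑ i, (w i : ℤ)) - (q + 1) * d - (∑ i, (w i : ℤ) - q * d) =
          -(2 * ∑ i, (w i : ℤ) + d) := by ring
      rw [h3, hH _ _ le_rfl (by omega), hH _ _ h1 le_rfl, hG_neg, hG, partialSum_self, h4, abs_neg]
      exact hw
  · funext i
    have h1 := hH0 i i.2.le
    have h2 := hH0 (i + 1) i.2
    rw [partialSum_succ w i.2] at h2
    push_cast at h2
    rw [stepWord, h1, h2, add_sub_cancel_left]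
    cases w i <;> decide

theorem stepWord_bijOn {n d δ : ℤ} {m : ℕ} (hδ : δ = 0 ∨ δ = 1) (hn : n = 2 * m + 1 + δ) :
    Set.BijOn (stepWord m) (oddPeriodicPaths n d δ)
      {w : Fin m → SignType | |2 * ∑ i, (w i : ℤ) + d| ≤ 1} :=
  ⟨fun _ hH => stepWord_mem hδ hn hH, stepWord_injOn hδ hn,
    fun _ hw => exists_stepWord_eq hδ hn hw⟩

theorem Set.BijOn.finite_and_ncard_eq {α β : Type*} {f : α → β} {s : Set α} {t : Set β}
    (h : Set.BijOn f s t) (ht : t.Finite) : s.Finite ∧ s.ncard = t.ncard :=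
  ⟨Set.Finite.of_finite_image (h.image_eq ▸ ht) h.injOn,
    by rw [← h.image_eq, h.injOn.ncard_image]⟩

/-! ### The number of self-conjugate cores -/

theorem betaSet_bijOn {s d : ℕ} (hs : 0 < s) (hd : 0 < d) {δ x₀ : ℤ}
    (hnd : IsCoprime (d : ℤ) (s + d)) (hδ : δ = 0 ∨ δ = 1) (hx₀ : 2 * x₀ + 1 = δ * d - (s + d)) :
    Set.BijOn YoungDiagram.betaSet (selfConjugateCores s d) (symmetricCoreSets (s + d) d) := by
  have key : ∀ μ, μ ∈ selfConjugateCores s d ↔ μ.betaSet ∈ symmetricCoreSets (s + d) d := by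
    intro μ
    simp only [selfConjugateCores, symmetricCoreSets, Set.mem_ofPred_eq, μ.isSelfConjugate_iff,
      μ.isCore_iff hs, μ.isCore_iff (Nat.add_pos_left hs d),
      μ.isCore_iff (Nat.add_pos_left hs (2 * d))]
    push_cast
    rw [add_sub_cancel_right, add_assoc, ← two_mul]
  refine ⟨fun μ hμ => (key μ).1 hμ, YoungDiagram.betaSet_injective.injOn, fun S hS => ?_⟩
  obtain ⟨H, hH, rfl⟩ := exists_subgraph_eq (by omega) hnd hδ hx₀ hS
  obtain ⟨N, hN⟩ := bddAbove_subgraph (x₀ := x₀) (by omega) (by omega) hnd hδ hH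
  obtain ⟨μ, hμ⟩ := YoungDiagram.exists_betaSet_eq hS.1 hN
  exact ⟨μ, (key μ).2 (hμ ▸ hS), hμ⟩

open Finset in
/-- Self-conjugate cores correspond to words of up, level and down steps, of about half the length
of a period, whose final height is as close to `-d / 2` as parity permits. -/
theorem selfConjugateCores_finite_and_ncard {s d : ℕ} (hs : 0 < s) (hd : 0 < d)
    (hsd : Nat.Coprime s d) :
    (selfConjugateCores s d).Finite ∧ (selfConjugateCores s d).ncard =
      #{w : Fin ((s + d - 1) / 2) → SignType | |2 * ∑ i, (w i : ℤ) + d| ≤ 1} := by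
  -- `δ` is the parity of `s + d - 1`; for `δ = 1` coprimality makes `d` odd, so that `x₀` exists.
  obtain ⟨δ, hδ, hn⟩ : ∃ δ : ℤ, (δ = 0 ∨ δ = 1) ∧
      ((s : ℤ) + d) = 2 * ((s + d - 1) / 2 : ℕ) + 1 + δ :=
    ⟨((s + d - 1) % 2 : ℕ), by omega, by omega⟩
  obtain ⟨x₀, hx₀⟩ : ∃ x₀ : ℤ, 2 * x₀ + 1 = δ * d - (s + d) := by
    rcases hδ with rfl | rfl
    · exact ⟨-((s + d - 1) / 2 : ℕ) - 1, by omega⟩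
    · have h1 : s % 2 = 1 := by
        by_contra h
        have h2 : 2 ∣ Nat.gcd s d := Nat.dvd_gcd (by omega) (by omega)
        rw [hsd] at h2
        omega
      exact ⟨-((s + 1) / 2 : ℕ), by omega⟩
  have hnd : IsCoprime (d : ℤ) (s + d) := by
    have h1 : IsCoprime (d : ℤ) s := (Nat.isCoprime_iff_coprime.2 hsd).symm
    simpa using h1.add_mul_left_right 1
  have hfin : {w : Fin ((s + d - 1) / 2) → SignType | |2 * ∑ i, (w i : ℤ) + d| ≤ 1}.Finite :=
    Set.toFinite _
  obtain ⟨hfin₁, hcard₁⟩ := (stepWord_bijOn hδ hn).finite_and_ncard_eq hfin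
  have hfin₂ : (symmetricCoreSets ((s : ℤ) + d) d).Finite ∧
      (symmetricCoreSets ((s : ℤ) + d) d).ncard = (oddPeriodicPaths ((s : ℤ) + d) d δ).ncard := by
    have h1 := subgraph_bijOn (n := (s : ℤ) + d) (by omega) hnd hδ hx₀
    rw [← h1.image_eq]
    exact ⟨hfin₁.image _, h1.injOn.ncard_image⟩
  obtain ⟨hfin₃, hcard₃⟩ := (betaSet_bijOn hs hd hnd hδ hx₀).finite_and_ncard_eq hfin₂.1
  refine ⟨hfin₃, ?_⟩
  rw [hcard₃, hfin₂.2, hcard₁, ← Set.ncard_coe_finset]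
  congr 1
  ext w
  simp

theorem theorem3p2 (s d : ℕ) (hs : 0 < s) (hd : 0 < d) (hsd : Nat.Coprime s d) :
    (selfConjugateCores s d).Finite ∧
    (Even d → (selfConjugateCores s d).ncard =
      ∑ i ∈ Finset.range (s / 4 + 1),
        trinomial ((s + d - 1) / 2) i (d / 2 + i) ((s - 1) / 2 - 2 * i)) ∧
    (Odd d → (selfConjugateCores s d).ncard =
      ∑ i ∈ Finset.range (s / 2 + 1),
        trinomial ((s + d - 1) / 2) (i / 2) ((d + i) / 2) (s / 2 - i)) := by
  obtain ⟨hfin, hcard⟩ := selfConjugateCores_finite_and_ncard hs hd hsd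
  exact ⟨hfin, fun he => hcard.trans (card_words_of_even hs hsd he),
    fun ho => hcard.trans (card_words_of_odd hs ho)⟩
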